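/- Conventions. All functions are complex-valued on $\mathbb{R}$, $\widehat f(\xi)=\int_{\mathbb{R}} f(x)e^{-2i\pi x\xi}\,dx$ is extended to $L^2(\mathbb{R})$ as usual, and $S,\Sigma\subset\mathbb{R}$ are Lebesgue measurable. For $f\in L^2(\mathbb{R})$, "$f$ is supported in $S$" means $f=0$ a.e. on $\mathbb{R}\setminus S$, and "$f$ has spectrum in $\Sigma$" means that $\widehat f$ is supported in $\Sigma$. The pair $(S,\Sigma)$ is a (weak) annihilating pair if every $f\in L^2(\mathbb{R})$ that is supported in $S$ and has spectrum in $\Sigma$ is $0$. It is a strong annihilating pair if there is a constant $C$ with $\|f\|_{2}\le C\bigl(\|f\|_{L^2(\mathbb{R}\setminus S)}+\|\widehat f\|_{L^2(\mathbb{R}\setminus\Sigma)}\bigr)$ for all $f\in L^2(\mathbb{R})$, and a strong annihilating pair with constant $D>0$ if $\|f\|_{L^2(\mathbb{R}\setminus S)}\ge D\|f\|_{2}$ for all $f\in L^2(\mathbb{R})$ with spectrum in $\Sigma$. For $v_0\in L^2(\mathbb{R})$, a solution of the free Schrödinger equation $i\partial_t v+\frac1{4\pi}\partial_x^2v=0$,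 $v(\cdot,0)=v_0$, is a map $t\mapsto v(\cdot,t)$ in $C([0,\infty);L^2(\mathbb{R}))$ with $v(\cdot,0)=v_0$ that satisfies the equation weakly in $x$: for every Schwartz function $\varphi$, the function $t\mapsto\int v(x,t)\varphi(x)\,dx$ is differentiable on $(0,\infty)$, and $i\frac{d}{dt}\int v(x,t)\varphi(x)\,dx+\frac1{4\pi}\int v(x,t)\varphi''(x)\,dx=0$ for all $t>0$. Theorem. Let $S,\Sigma\subset\mathbb{R}$ be measurable. 1. Suppose that $(S,\Sigma)$ is an annihilating pair, that $v$ is a solution with initial data $v_0\in L^2(\mathbb{R})$, and that $v_0$ has spectrum in $\Sigma$. If $v(\cdot,t)$ is supported in $S$ for some $t>0$, then $v_0=0$. 2. The pair $(S,\Sigma)$ is a strong annihilating pair if and only if it is a strong annihilating pair with some constant $D>0$. If it is one with constant $D$, then for every solution $v$ whose initial data $v_0\in L^2(\mathbb{R})$ has spectrum in $\Sigma$ and for all $t\ge0$, $$\|v(\cdot,t)\|_{L^2(\mathbb{R}\setminus S)}\ \ge\ D\,\|v(\cdot,t)\|_{2}=D\,\|v_0\|_{2},\qquad \|v(\cdot,t)\|_2=\|v_0\|_2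 .$$ 3. If $S$ and $\Sigma$ have finite measure, then $(S,\Sigma)$ is an annihilating pair and a strong annihilating pair, so that 1 and 2 apply. In particular there is $D>0$, depending only on $S$ and $\Sigma$, such that $(S,\Sigma)$ is a strong annihilating pair with constant $D$ and, for every solution $v$ whose initial data $v_0\in L^2(\mathbb{R})$ has spectrum in $\Sigma$ and for all $t\ge0$, $$\int_{\mathbb{R}\setminus S}|v(x,t)|^2\,dx\ \ge\ D^2\,\|v_0\|_{2}^2 ,$$ that is, a fixed fraction of the energy always lies outside $S$. -/

import Mathlib

open MeasureTheory FourierTransform SchwartzMap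

/-- The space `L²(ℝ)` of complex-valued functions, with respect to Lebesgue measure. -/
abbrev L2R : Type := Lp ℂ 2 (volume : Measure ℝ)

/-- `f` is supported in `A`: it vanishes almost everywhere outside `A`. -/
def SupportedIn (f : L2R) (A : Set ℝ) : Prop :=
  ∀ᵐ x : ℝ, x ∉ A → f x = 0

/-- `f` has spectrum in `A`: its Fourier transform, `f̂(ξ) = ∫ f(x) e^{-2iπxξ} dx` extended to
`L²(ℝ)`, is supported in `A`. -/
def SpectrumIn (f : L2R) (A : Set ℝ) : Prop :=
  SupportedIn (𝓕 f : L2R) A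

/-- The norm `‖f‖_{L²(A)} = (∫_A |f|²)^{1/2}`. -/
noncomputable def l2NormOn (A : Set ℝ) (f : L2R) : ℝ :=
  (eLpNorm f 2 (volume.restrict A)).toReal

/-- `(S, T)` is a (weak) annihilating pair. -/
def IsAnnihilatingPair (S T : Set ℝ) : Prop :=
  ∀ f : L2R, SupportedIn f S → SpectrumIn f T → f = 0

/-- `(S, T)` is a strong annihilating pair:
`‖f‖₂ ≤ C (‖f‖_{L²(ℝ∖S)} + ‖f̂‖_{L²(ℝ∖T)})` for all `f ∈ L²(ℝ)`. -/
def IsStrongAnnihilatingPair (S T : Set ℝ) : Prop :=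
  ∃ C : ℝ, ∀ f : L2R, ‖f‖ ≤ C * (l2NormOn Sᶜ f + l2NormOn Tᶜ (𝓕 f : L2R))

/-- `(S, T)` is a strong annihilating pair with constant `D > 0`:
`‖f‖_{L²(ℝ∖S)} ≥ D ‖f‖₂` for all `f ∈ L²(ℝ)` with spectrum in `T`. -/
def IsStrongAnnihilatingPairWith (S T : Set ℝ) (D : ℝ) : Prop :=
  0 < D ∧ ∀ f : L2R, SpectrumIn f T → D * ‖f‖ ≤ l2NormOn Sᶜ f

/-- `v ∈ C([0,∞); L²(ℝ))` is a solution of the free Schrödinger equation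
`i ∂ₜv + (1/4π) ∂ₓ²v = 0` on `(0,∞) × ℝ` with `v(·,0) = v₀`. The equation is understood weakly:
for each Schwartz function `φ` the function `t ↦ ∫ v(x,t) φ(x) dx` is differentiable on `(0,∞)`
and its derivative `d(t)` satisfies `i d(t) + (1/4π) ∫ v(x,t) φ''(x) dx = 0`. -/
structure IsFreeSchrodingerSolution (v₀ : L2R) (v : ℝ → L2R) : Prop where
  continuousOn : ContinuousOn v (Set.Ici 0)
  initial : v 0 = v₀
  equation : ∀ φ : 𝓢(ℝ, ℂ), ∀ t : ℝ, 0 < t → ∃ d : ℂ,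
    HasDerivAt (fun s : ℝ => ∫ x : ℝ, v s x * φ x) d t ∧
    Complex.I * d + (1 / (4 * (Real.pi : ℂ))) * ∫ x : ℝ, v t x * deriv (deriv φ) x = 0

/-! ### The Fourier transform on `L²(ℝ)` and the pointwise inversion formula -/

/-! On the Fourier side the equation is solved by `v̂(ξ,t) = e^{-iπtξ²} v̂₀(ξ)`
(`IsFreeSchrodingerSolution.fourier_eq`). The modulus of `v̂(·,t)` is therefore constant in time, so
norm and spectrum are conserved, and the assertions on solutions follow by applying the annihilation
property to `v(·,t)`. For weak solutions the formula comes from showing that `∫ v̂(ξ,s) e^{iπsξ²}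
ψ(ξ) dξ` does not depend on `s`.

For `S`, `T` of finite measure, a function with spectrum in `T` satisfies `f(x) = ⟨k_x, f̂⟩` with
`‖k_x‖² = |T|` (`SpectrumIn.ae_eq_inner`). Bessel's inequality, integrated over `S`, bounds by
`|S||T|` the dimension of the space of functions supported in `S` with spectrum in `T`
(`Orthonormal.card_le`). A nonzero such function has `N` linearly independent small translates,
supported in a set of measure at most `|S| + 1`; this is absurd for large `N`, hence weak
annihilation.

The strong form follows by compactness: for normalized functions with spectrum in `T` whose mass
outside `S` tends to zero, weak convergence of the transforms becomes bounded pointwise convergence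
through the kernel. The limit then has all its mass in `S`, against the weak form. -/

lemma memLp_L2R (f : L2R) : MemLp f 2 (volume : Measure ℝ) := Lp.memLp f

lemma integral_L2_fourier_mul (f : L2R) (φ : 𝓢(ℝ, ℂ)) :
    ∫ x, (𝓕 f : L2R) x * φ x = ∫ x, f x * (𝓕 φ) x := by
  have h := congrArg (fun u : 𝓢'(ℝ, ℂ) => u φ) (Lp.fourier_toTemperedDistribution_eq f)
  simp only [TemperedDistribution.fourier_apply, Lp.toTemperedDistribution_apply,
    smul_eq_mul] at h
  simpa only [mul_comm] using h.symm

lemma SupportedIn.ae_eq_indicator {f : L2R} {A : Set ℝ} (h : SupportedIn f A) :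
    (f : ℝ → ℂ) =ᵐ[volume] A.indicator f := by
  filter_upwards [h] with x hx
  by_cases hA : x ∈ A
  · simp [hA]
  · simp [hA, hx hA]

lemma SupportedIn.integrable {f : L2R} {A : Set ℝ} (h : SupportedIn f A) (hA : MeasurableSet A)
    (hfin : volume A < ⊤) : Integrable (f : ℝ → ℂ) := by
  have : IsFiniteMeasure (volume.restrict A) := ⟨by simpa using hfin⟩
  refine Integrable.congr ?_ h.ae_eq_indicator.symm
  rw [integrable_indicator_iff hA]
  exact ((memLp_L2R f).restrict A).integrable (by norm_num)

lemma integral_fourier_mul_of_integrable {f g : ℝ → ℂ} (hf : Integrable f) (hg : Integrable g) :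
    ∫ x, (𝓕 f) x * g x = ∫ x, f x * (𝓕 g) x := by
  simpa using! VectorFourier.integral_fourierIntegral_smul_eq_flip (L := innerₗ ℝ)
    Real.continuous_fourierChar continuous_inner hf hg

lemma integral_fourierInv_mul_of_integrable {f g : ℝ → ℂ} (hf : Integrable f)
    (hg : Integrable g) :
    ∫ x, (𝓕⁻ f) x * g x = ∫ x, f x * (𝓕⁻ g) x := by
  rw [Real.fourierInv_eq_fourier_comp_neg, integral_fourier_mul_of_integrable hf.comp_neg hg,
    ← integral_neg_eq_self]
  simp [Real.fourierInv_eq_fourier_neg]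

lemma continuous_fourierInv_of_integrable {f : ℝ → ℂ} (hf : Integrable f) :
    Continuous (𝓕⁻ f) := by
  rw [Real.fourierInv_eq_fourier_comp_neg]
  exact VectorFourier.fourierIntegral_continuous (L := innerₗ ℝ) Real.continuous_fourierChar
    continuous_inner hf.comp_neg

/-- Pointwise Fourier inversion for `f ∈ L²` with integrable Fourier transform. -/
lemma ae_eq_fourierInv_of_integrable {f : L2R} (h : Integrable ((𝓕 f : L2R) : ℝ → ℂ)) :
    ∀ᵐ x : ℝ, f x = (𝓕⁻ ((𝓕 f : L2R) : ℝ → ℂ)) x := by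
  refine ae_eq_of_integral_contDiff_smul_eq
    ((memLp_L2R f).locallyIntegrable (by norm_num))
    (continuous_fourierInv_of_integrable h).locallyIntegrable fun g hg hgc => ?_
  have hg₁ : HasCompactSupport (Complex.ofRealCLM ∘ g) := hgc.comp_left rfl
  have hg₂ : ContDiff ℝ (⊤ : ℕ∞) (Complex.ofRealCLM ∘ g) := by fun_prop
  set φ : 𝓢(ℝ, ℂ) := hg₁.toSchwartzMap hg₂
  have hφ : ∀ x, (g x : ℂ) = φ x := fun x => rfl
  -- Writing `φ = 𝓕 (𝓕⁻ φ)`, both sides tested against `φ` become the pairing of `𝓕 f` with `𝓕⁻ φ`.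
  have h1 := integral_L2_fourier_mul f (𝓕⁻ φ)
  rw [fourier_fourierInv_eq] at h1
  have h2 := integral_fourierInv_mul_of_integrable h φ.integrable
  simp only [Complex.real_smul, hφ]
  rw [SchwartzMap.fourierInv_coe] at h1
  simp_rw [mul_comm (φ _)]
  rw [h2, ← h1]

/-! ### The reproducing kernel of functions with spectrum in a set of finite measure -/

/-- The function `ξ ↦ 1_T(ξ) e^{-2πixξ}`. -/
noncomputable def bandKernelFun (T : Set ℝ) (x : ℝ) : ℝ → ℂ :=
  T.indicator fun ξ => Complex.exp (-(2 * Real.pi * x * ξ : ℝ) * Complex.I)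

lemma norm_bandKernelFun (T : Set ℝ) (x ξ : ℝ) :
    ‖bandKernelFun T x ξ‖ = T.indicator (fun _ => (1 : ℝ)) ξ := by
  by_cases h : ξ ∈ T
  · rw [bandKernelFun, Set.indicator_of_mem h, Set.indicator_of_mem h, ← Complex.ofReal_neg,
      Complex.norm_exp_ofReal_mul_I]
  · simp [bandKernelFun, h]

lemma memLp_bandKernelFun {T : Set ℝ} (hT : MeasurableSet T) (hfin : volume T < ⊤) (x : ℝ) :
    MemLp (bandKernelFun T x) 2 (volume : Measure ℝ) := by
  have h1 : MemLp (T.indicator fun _ => (1 : ℝ)) 2 (volume : Measure ℝ) :=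
    memLp_indicator_const 2 hT 1 (Or.inr hfin.ne)
  refine h1.mono ?_ (.of_forall fun ξ => ?_)
  · exact ((by fun_prop : Measurable fun ξ : ℝ =>
      Complex.exp (-(2 * Real.pi * x * ξ : ℝ) * Complex.I)).indicator hT).aestronglyMeasurable
  · rw [norm_bandKernelFun]
    exact le_abs_self _

/-- `ξ ↦ 1_T(ξ) e^{-2πixξ}` as an element of `L²(ℝ)`. -/
noncomputable def bandKernel {T : Set ℝ} (hT : MeasurableSet T) (hfin : volume T < ⊤) (x : ℝ) :
    L2R := (memLp_bandKernelFun hT hfin x).toLp _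

lemma L2R_norm_sq (f : L2R) : ‖f‖ ^ 2 = ∫ x, ‖f x‖ ^ 2 := by
  have h : (inner ℂ f f : ℂ) = ((∫ x, ‖f x‖ ^ 2 : ℝ) : ℂ) := by
    rw [L2.inner_def, ← integral_complex_ofReal]
    refine integral_congr_ae (.of_forall fun x => ?_)
    simp [inner_self_eq_norm_sq_to_K]
  rw [inner_self_eq_norm_sq_to_K] at h
  exact Complex.ofReal_injective (by simpa using h)

lemma integrable_norm_sq (f : L2R) : Integrable fun x => ‖f x‖ ^ 2 :=
  (memLp_L2R f).integrable_norm_pow (by norm_num)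

lemma norm_sq_bandKernel {T : Set ℝ} (hT : MeasurableSet T) (hfin : volume T < ⊤) (x : ℝ) :
    ‖bandKernel hT hfin x‖ ^ 2 = volume.real T := by
  rw [L2R_norm_sq, ← integral_indicator_one hT]
  refine integral_congr_ae ?_
  filter_upwards [(memLp_bandKernelFun hT hfin x).coeFn_toLp] with ξ h
  rw [bandKernel, h, norm_bandKernelFun]
  by_cases hξ : ξ ∈ T <;> simp [hξ]

lemma inner_bandKernel {T : Set ℝ} (hT : MeasurableSet T) (hfin : volume T < ⊤) (x : ℝ)
    {g : L2R} (hg : SupportedIn g T) :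
    inner ℂ (bandKernel hT hfin x) g = (𝓕⁻ (g : ℝ → ℂ)) x := by
  rw [L2.inner_def, Real.fourierInv_eq']
  refine integral_congr_ae ?_
  filter_upwards [(memLp_bandKernelFun hT hfin x).coeFn_toLp, hg] with ξ h hξ
  rw [bandKernel, h, RCLike.inner_apply, bandKernelFun]
  by_cases hT : ξ ∈ T
  · rw [Set.indicator_of_mem hT, ← Complex.exp_conj, smul_eq_mul, mul_comm]
    congr 2
    simp only [map_mul, map_neg, Complex.conj_ofReal, Complex.conj_I, Real.inner_apply]
    push_cast
    ring
  · simp [hξ hT]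

/-- Finite measure of `T` makes the transform integrable, so pointwise inversion applies. Point
values become inner products with vectors of norm `|T|^{1/2}`. -/
lemma SpectrumIn.ae_eq_inner {T : Set ℝ} (hT : MeasurableSet T) (hfin : volume T < ⊤)
    {f : L2R} (hf : SpectrumIn f T) :
    ∀ᵐ x : ℝ, f x = inner ℂ (bandKernel hT hfin x) (𝓕 f : L2R) := by
  filter_upwards [ae_eq_fourierInv_of_integrable (SupportedIn.integrable hf hT hfin)] with x hx
  rw [hx, inner_bandKernel hT hfin x hf]

lemma Orthonormal.fourier {ι : Type*} {e : ι → L2R} (he : Orthonormal ℂ e) :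
    Orthonormal ℂ fun i => (𝓕 (e i) : L2R) :=
  he.comp_linearIsometryEquiv (Lp.fourierTransformₗᵢ ℝ ℂ)

lemma integral_norm_sq_of_supportedIn {f : L2R} {S : Set ℝ} (hS : MeasurableSet S)
    (hf : SupportedIn f S) : ∫ x in S, ‖f x‖ ^ 2 = ‖f‖ ^ 2 := by
  rw [L2R_norm_sq, ← integral_indicator hS]
  refine integral_congr_ae ?_
  filter_upwards [hf] with x hx
  by_cases h : x ∈ S <;> simp [h, hx]

/-- An orthonormal family of functions supported in `S` with spectrum in `T` has at most
`|S| |T|` members. -/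
lemma Orthonormal.card_le {ι : Type*} [Fintype ι] {S T : Set ℝ} (hS : MeasurableSet S)
    (hT : MeasurableSet T) (hSfin : volume S < ⊤) (hTfin : volume T < ⊤) {e : ι → L2R}
    (he : Orthonormal ℂ e) (heS : ∀ i, SupportedIn (e i) S) (heT : ∀ i, SpectrumIn (e i) T) :
    (Fintype.card ι : ℝ) ≤ volume.real S * volume.real T := by
  -- Bessel's inequality for the orthonormal family `𝓕 (e i)` and the kernel at `x`.
  have h1 : ∀ᵐ x : ℝ, ∑ i, ‖e i x‖ ^ 2 ≤ volume.real T := by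
    filter_upwards [ae_all_iff.2 fun i => (heT i).ae_eq_inner hT hTfin] with x hx
    rw [← norm_sq_bandKernel hT hTfin x]
    refine le_trans (le_of_eq ?_) (he.fourier.sum_inner_products_le (bandKernel hT hTfin x)
      (s := Finset.univ))
    refine Finset.sum_congr rfl fun i _ => ?_
    rw [hx i, norm_inner_symm]
  calc (Fintype.card ι : ℝ) = ∑ i, ∫ x in S, ‖e i x‖ ^ 2 := by
        simp [integral_norm_sq_of_supportedIn hS (heS _), he.1]
    _ = ∫ x in S, ∑ i, ‖e i x‖ ^ 2 :=
        (integral_finsetSum _ fun i _ => (integrable_norm_sq (e i)).integrableOn).symm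
    _ ≤ ∫ x in S, volume.real T := by
        refine integral_mono_ae ?_ ?_ (ae_restrict_of_ae h1)
        · exact integrable_finsetSum _ fun i _ => (integrable_norm_sq (e i)).integrableOn
        · exact integrableOn_const hSfin.ne
    _ = volume.real S * volume.real T := by simp

/-! ### Sets of finite measure form annihilating pairs -/

/-- The product of an `L²` function with a unimodular function. -/
lemma exists_ae_eq_unimodular_mul (f : L2R) {m : ℝ → ℂ} (hm : Measurable m)
    (h1 : ∀ ξ, ‖m ξ‖ = 1) : ∃ g : L2R, ∀ᵐ ξ : ℝ, g ξ = m ξ * f ξ := by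
  have h : MemLp (fun ξ => m ξ * f ξ) 2 (volume : Measure ℝ) := by
    refine (memLp_L2R f).mono (hm.aestronglyMeasurable.mul (memLp_L2R f).1) (.of_forall fun ξ => ?_)
    simp [h1]
  exact ⟨h.toLp _, h.coeFn_toLp⟩

/-- The translate is built by a phase on the Fourier side, which leaves the spectrum in `T`;
pointwise inversion identifies it with `f(x - a)` and thus locates its support. -/
lemma exists_translate {S T : Set ℝ} (hT : MeasurableSet T) (hTfin : volume T < ⊤) {f : L2R}
    (hfS : SupportedIn f S) (hfT : SpectrumIn f T) (a : ℝ) :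
    ∃ g : L2R, SupportedIn g ((fun x => x - a) ⁻¹' S) ∧ SpectrumIn g T ∧
      ∀ᵐ ξ : ℝ, (𝓕 g : L2R) ξ =
        Complex.exp (-(2 * Real.pi * a * ξ : ℝ) * Complex.I) * (𝓕 f : L2R) ξ := by
  obtain ⟨h, hh⟩ := exists_ae_eq_unimodular_mul (𝓕 f : L2R)
    (m := fun ξ => Complex.exp (-(2 * Real.pi * a * ξ : ℝ) * Complex.I)) (by fun_prop) fun ξ => by
      rw [← Complex.ofReal_neg, Complex.norm_exp_ofReal_mul_I]
  have hF : (𝓕 (𝓕⁻ h : L2R) : L2R) = h := fourier_fourierInv_eq h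
  have hs : SpectrumIn (𝓕⁻ h : L2R) T := by
    rw [SpectrumIn, hF]
    filter_upwards [hh, hfT] with ξ h1 h2 h3
    rw [h1, h2 h3, mul_zero]
  refine ⟨𝓕⁻ h, ?_, hs, by rwa [hF]⟩
  have hi := SupportedIn.integrable hfT hT hTfin
  have hi' := SupportedIn.integrable hs hT hTfin
  have hq := (measurePreserving_sub_right (volume : Measure ℝ) a).quasiMeasurePreserving
  filter_upwards [ae_eq_fourierInv_of_integrable hi', hq.ae (ae_eq_fourierInv_of_integrable hi),
    hq.ae hfS] with x h1 h2 h3 hx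
  rw [h1, ← h3 hx, h2, Real.fourierInv_eq', Real.fourierInv_eq', hF]
  refine integral_congr_ae ?_
  filter_upwards [hh] with ξ h4
  rw [h4, smul_eq_mul, smul_eq_mul, ← mul_assoc, ← Complex.exp_add]
  congr 2
  simp only [Real.inner_apply]
  push_cast
  ring

/-- For a set of finite measure, `N` sufficiently small translates cover little more. -/
lemma exists_pos_volume_iUnion_translates_lt {S : Set ℝ} (hS : MeasurableSet S)
    (hfin : volume S < ⊤) (N : ℕ) :
    ∃ a : ℝ, 0 < a ∧
      volume (⋃ k : Fin N, (fun x : ℝ => x - (k : ℕ) * a) ⁻¹' S) ≤ volume S + 1 := by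
  have key : ∀ k : Fin N, Filter.Tendsto
      (fun a : ℝ => volume (((fun x : ℝ => x - (k : ℕ) * a) ⁻¹' S) \ S)) (nhds 0) (nhds 0) := by
    intro k
    let F : C(ℝ, C(ℝ, ℝ)) := ContinuousMap.curry ⟨fun p : ℝ × ℝ => p.2 - (k : ℕ) * p.1, by fun_prop⟩
    -- Continuity of translation in measure, valid because `S` has finite measure.
    have h := tendsto_measure_symmDiff_preimage_nhds_zero (μ := volume) (ν := volume)
      (f := fun a => F a) (g := F 0) (s := S) (l := nhds (0 : ℝ)) (F.continuous.tendsto 0)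
      (.of_forall fun a => measurePreserving_sub_right volume ((k : ℕ) * a : ℝ))
      (measurePreserving_sub_right volume ((k : ℕ) * 0 : ℝ)) hS.nullMeasurableSet hfin.ne
    refine tendsto_of_tendsto_of_tendsto_of_le_of_le tendsto_const_nhds h
      (fun _ => zero_le) fun a => measure_mono fun x hx => Or.inl ⟨hx.1, ?_⟩
    intro hx'
    apply hx.2
    simpa [F] using hx'
  have hsum : Filter.Tendsto
      (fun a : ℝ => ∑ k : Fin N, volume (((fun x : ℝ => x - (k : ℕ) * a) ⁻¹' S) \ S))
      (nhds 0) (nhds 0) := by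
    simpa using tendsto_finsetSum Finset.univ fun k _ => key k
  have hev := (hsum.eventually (ge_mem_nhds (zero_lt_one))).filter_mono
    (nhdsWithin_le_nhds (s := Set.Ioi 0))
  obtain ⟨a, ha, ha0⟩ := (hev.and self_mem_nhdsWithin).exists
  refine ⟨a, ha0, ?_⟩
  calc volume (⋃ k : Fin N, (fun x : ℝ => x - (k : ℕ) * a) ⁻¹' S)
      ≤ volume (S ∪ ⋃ k : Fin N, ((fun x : ℝ => x - (k : ℕ) * a) ⁻¹' S) \ S) := by
        refine measure_mono (Set.iUnion_subset fun k x hx => ?_)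
        by_cases hxS : x ∈ S
        · exact Or.inl hxS
        · exact Or.inr (Set.mem_iUnion.2 ⟨k, hx, hxS⟩)
    _ ≤ volume S + volume (⋃ k : Fin N, ((fun x : ℝ => x - (k : ℕ) * a) ⁻¹' S) \ S) :=
        measure_union_le _ _
    _ ≤ volume S + 1 := by
        gcongr
        exact (measure_iUnion_fintype_le _ _).trans ha

/-- Any two solutions differ by an integer multiple of `1/a`. -/
lemma countable_setOf_exp_eq {a : ℝ} (ha : a ≠ 0) (z : ℂ) :
    {ξ : ℝ | Complex.exp (-(2 * Real.pi * a * ξ : ℝ) * Complex.I) = z}.Countable := by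
  rcases Set.eq_empty_or_nonempty
    {ξ : ℝ | Complex.exp (-(2 * Real.pi * a * ξ : ℝ) * Complex.I) = z} with h | ⟨ξ₀, h₀⟩
  · rw [h]
    exact Set.countable_empty
  refine (Set.countable_range fun n : ℤ => ξ₀ - n / a).mono fun ξ hξ => ?_
  obtain ⟨n, hn⟩ := Complex.exp_eq_exp_iff_exists_int.1 (hξ.trans h₀.symm)
  refine ⟨n, ?_⟩
  have h2 : (2 * Real.pi * Complex.I) ≠ 0 := Complex.two_pi_I_ne_zero
  have h3 : (-(a * ξ : ℝ) : ℂ) = (-(a * ξ₀ : ℝ) : ℂ) + n := by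
    apply mul_left_cancel₀ h2
    push_cast at hn ⊢
    linear_combination hn
  have h4 : -(a * ξ) = -(a * ξ₀) + n := by exact_mod_cast h3
  simp only
  field_simp
  linarith

/-- A nontrivial exponential polynomial vanishes only on a null set. -/
lemma ae_sum_exp_ne_zero {a : ℝ} (ha : a ≠ 0) {N : ℕ} {c : Fin N → ℂ} (hc : c ≠ 0) :
    ∀ᵐ ξ : ℝ, ∑ k : Fin N,
      c k * Complex.exp (-(2 * Real.pi * ((k : ℕ) * a) * ξ : ℝ) * Complex.I) ≠ 0 := by
  -- The sum is `p` evaluated at `e^{-2πiaξ}`; each of the finitely many roots is attained for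
  -- countably many `ξ`.
  set p : Polynomial ℂ := ∑ k : Fin N, Polynomial.monomial (k : ℕ) (c k)
  have hp : p ≠ 0 := by
    obtain ⟨j, hj⟩ := Function.ne_iff.1 hc
    intro h0
    apply hj
    have := congrArg (fun q => Polynomial.coeff q (j : ℕ)) h0
    simpa [p, Polynomial.finsetSum_coeff, Polynomial.coeff_monomial, Fin.val_inj] using this
  have hcount : (⋃ z ∈ p.roots.toFinset,
      {ξ : ℝ | Complex.exp (-(2 * Real.pi * a * ξ : ℝ) * Complex.I) = z}).Countable :=
    p.roots.toFinset.countable_toSet.biUnion fun z _ => countable_setOf_exp_eq ha z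
  filter_upwards [hcount.ae_notMem volume] with ξ hξ h0
  apply hξ
  simp only [Set.mem_iUnion, Multiset.mem_toFinset, Set.mem_ofPred_eq, exists_prop,
    exists_eq_right', Polynomial.mem_roots hp, Polynomial.IsRoot.def]
  rw [← h0]
  simp only [p, Polynomial.eval_finsetSum, Polynomial.eval_monomial]
  refine Finset.sum_congr rfl fun k _ => ?_
  rw [← Complex.exp_nat_mul]
  congr 2
  push_cast
  ring

lemma SupportedIn.mono {f : L2R} {A B : Set ℝ} (h : SupportedIn f A) (hAB : A ⊆ B) :
    SupportedIn f B := by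
  filter_upwards [h] with x hx hB using hx fun hA => hB (hAB hA)

/-- The subspace of `L²` functions supported in `A`. -/
def supportedSubmodule (A : Set ℝ) : Submodule ℂ L2R where
  carrier := {f | SupportedIn f A}
  zero_mem' := by
    filter_upwards [Lp.coeFn_zero ℂ 2 (volume : Measure ℝ)] with x hx _
    rw [hx, Pi.zero_apply]
  add_mem' {f g} hf hg := by
    filter_upwards [hf, hg, Lp.coeFn_add f g] with x h1 h2 h3 hx
    rw [h3, Pi.add_apply, h1 hx, h2 hx, add_zero]
  smul_mem' c f hf := by
    filter_upwards [hf, Lp.coeFn_smul c f] with x h1 h2 hx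
    rw [h2, Pi.smul_apply, h1 hx, smul_zero]

/-- The subspace of `L²` functions supported in `S` with spectrum in `T`. -/
noncomputable def concentratedSubmodule (S T : Set ℝ) : Submodule ℂ L2R :=
  supportedSubmodule S ⊓
    (supportedSubmodule T).comap (Lp.fourierTransformₗᵢ ℝ ℂ).toLinearEquiv.toLinearMap

lemma coeFn_sum_smul {ι : Type*} (s : Finset ι) (c : ι → ℂ) (g : ι → L2R) :
    ∀ᵐ x : ℝ, (∑ i ∈ s, c i • g i : L2R) x = ∑ i ∈ s, c i * g i x := by
  classical
  induction s using Finset.induction_on with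
  | empty =>
    filter_upwards [Lp.coeFn_zero ℂ 2 (volume : Measure ℝ)] with x hx
    rw [Finset.sum_empty, Finset.sum_empty, hx, Pi.zero_apply]
  | insert i s hi ih =>
    rw [Finset.sum_insert hi]
    filter_upwards [ih, Lp.coeFn_add (c i • g i) (∑ i ∈ s, c i • g i),
      Lp.coeFn_smul (c i) (g i)] with x h1 h2 h3
    rw [h2, Pi.add_apply, h1, h3, Pi.smul_apply, smul_eq_mul, Finset.sum_insert hi]

/-- The Amrein–Berthier–Benedicks theorem, weak form. -/
theorem isAnnihilatingPair_of_volume_lt_top {S T : Set ℝ} (hS : MeasurableSet S)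
    (hT : MeasurableSet T) (hSfin : volume S < ⊤) (hTfin : volume T < ⊤) :
    IsAnnihilatingPair S T := by
  intro f hfS hfT
  by_contra hf
  -- `|S| + 1` bounds the union of translates for every `N`, since the step `a` is chosen after `N`.
  obtain ⟨N, hN⟩ := exists_nat_gt ((volume.real S + 1) * volume.real T)
  obtain ⟨a, ha, hvol⟩ := exists_pos_volume_iUnion_translates_lt hS hSfin N
  set S' : Set ℝ := ⋃ k : Fin N, (fun x : ℝ => x - (k : ℕ) * a) ⁻¹' S
  have hS' : MeasurableSet S' := .iUnion fun k => (by fun_prop : Measurable fun x : ℝ =>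
    x - (k : ℕ) * a) hS
  have hS'fin : volume S' < ⊤ := hvol.trans_lt (by finiteness)
  choose g hgS hgT hg using fun k : Fin N => exists_translate hT hTfin hfS hfT ((k : ℕ) * a)
  have hind : LinearIndependent ℂ g := by
    rw [Fintype.linearIndependent_iff]
    intro c hc
    by_contra! hne
    have hc0 : c ≠ 0 := fun h => by simp [h] at hne
    have hF : (∑ k, c k • (𝓕 (g k) : L2R)) = 0 := by
      have := congrArg (Lp.fourierTransformₗᵢ ℝ ℂ) hc
      simp only [map_sum, map_smul, map_zero] at this
      exact this
    apply hf
    -- A linear relation says that an exponential polynomial times `𝓕 f` vanishes, and the former is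
    -- nonzero almost everywhere.
    have hz : (𝓕 f : L2R) = 0 := by
      rw [Lp.eq_zero_iff_ae_eq_zero]
      have hs := coeFn_sum_smul Finset.univ c fun k => (𝓕 (g k) : L2R)
      rw [hF] at hs
      filter_upwards [hs, Lp.coeFn_zero ℂ 2 (volume : Measure ℝ), ae_all_iff.2 hg,
        ae_sum_exp_ne_zero ha.ne' hc0] with ξ h1 h2 h3 h4
      rw [h2] at h1
      simp only [h3, Pi.zero_apply] at h1
      refine (mul_eq_zero.1 ?_).resolve_left h4
      rw [Finset.sum_mul, h1]
      exact Finset.sum_congr rfl fun k _ => mul_assoc _ _ _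
    rw [← norm_eq_zero, ← Lp.norm_fourier_eq f, hz, norm_zero]
  set W := Submodule.span ℂ (Set.range g)
  have hW : W ≤ concentratedSubmodule S' T := by
    rw [Submodule.span_le]
    rintro _ ⟨k, rfl⟩
    exact ⟨(hgS k).mono (Set.subset_iUnion (fun k : Fin N =>
      (fun x : ℝ => x - (k : ℕ) * a) ⁻¹' S) k), hgT k⟩
  have hdim : Module.finrank ℂ W = N := by rw [finrank_span_eq_card hind, Fintype.card_fin]
  have : FiniteDimensional ℂ W := .span_of_finite ℂ (Set.finite_range g)
  let b := stdOrthonormalBasis ℂ W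
  have hb : Orthonormal ℂ fun i => (b i : L2R) :=
    b.orthonormal.comp_linearIsometry W.subtypeₗᵢ
  have hle := hb.card_le hS' hT hS'fin hTfin (fun i => (hW (b i).2).1) fun i => (hW (b i).2).2
  rw [Fintype.card_fin, hdim] at hle
  have hreal : volume.real S' ≤ volume.real S + 1 := by
    have := ENNReal.toReal_mono (by finiteness) hvol
    rwa [ENNReal.toReal_add hSfin.ne ENNReal.one_ne_top, ENNReal.toReal_one] at this
  have := mul_le_mul_of_nonneg_right hreal (measureReal_nonneg (μ := volume) (s := T))
  linarith

/-! ### Strong annihilating pairs -/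

lemma l2NormOn_nonneg (A : Set ℝ) (f : L2R) : 0 ≤ l2NormOn A f := ENNReal.toReal_nonneg

lemma eLpNorm_restrict_ne_top (A : Set ℝ) (f : L2R) :
    eLpNorm f 2 (volume.restrict A) ≠ ⊤ := ((memLp_L2R f).restrict A).2.ne

lemma l2NormOn_le_norm (A : Set ℝ) (f : L2R) : l2NormOn A f ≤ ‖f‖ := by
  rw [l2NormOn, Lp.norm_def]
  exact ENNReal.toReal_mono (Lp.eLpNorm_ne_top f) (eLpNorm_restrict_le _ _ _ _)

lemma l2NormOn_add_le (A : Set ℝ) (f g : L2R) :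
    l2NormOn A (f + g) ≤ l2NormOn A f + l2NormOn A g := by
  rw [l2NormOn, l2NormOn, l2NormOn, ← ENNReal.toReal_add (eLpNorm_restrict_ne_top A f)
    (eLpNorm_restrict_ne_top A g)]
  refine ENNReal.toReal_mono (ENNReal.add_ne_top.2 ⟨eLpNorm_restrict_ne_top A f,
    eLpNorm_restrict_ne_top A g⟩) ?_
  rw [eLpNorm_congr_ae (ae_restrict_of_ae (Lp.coeFn_add f g))]
  exact eLpNorm_add_le ((memLp_L2R f).restrict A).1 ((memLp_L2R g).restrict A).1 (by norm_num)

lemma l2NormOn_smul (A : Set ℝ) (c : ℂ) (f : L2R) : l2NormOn A (c • f) = ‖c‖ * l2NormOn A f := by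
  rw [l2NormOn, l2NormOn, eLpNorm_congr_ae (ae_restrict_of_ae (Lp.coeFn_smul c f)),
    eLpNorm_const_smul, ENNReal.toReal_mul, toReal_enorm]

lemma l2NormOn_sq (A : Set ℝ) (f : L2R) : l2NormOn A f ^ 2 = ∫ x in A, ‖f x‖ ^ 2 := by
  have hm := (memLp_L2R f).restrict A
  have h0 : 0 ≤ ∫ x in A, ‖f x‖ ^ 2 := integral_nonneg fun x => by positivity
  rw [l2NormOn, hm.eLpNorm_eq_integral_rpow_norm (by norm_num) (by norm_num)]
  simp only [ENNReal.toReal_ofNat, Real.rpow_ofNat]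
  rw [ENNReal.toReal_ofReal (by positivity), ← Real.rpow_natCast, ← Real.rpow_mul h0]
  norm_num

lemma l2NormOn_compl_eq_zero_iff {A : Set ℝ} (hA : MeasurableSet A) (f : L2R) :
    l2NormOn Aᶜ f = 0 ↔ SupportedIn f A := by
  rw [l2NormOn, ENNReal.toReal_eq_zero_iff, or_iff_left (eLpNorm_restrict_ne_top _ f),
    eLpNorm_eq_zero_iff ((memLp_L2R f).restrict _).1 (by norm_num), Filter.EventuallyEq,
    ae_restrict_iff' hA.compl]
  rfl

lemma l2NormOn_sq_add_compl {A : Set ℝ} (hA : MeasurableSet A) (f : L2R) :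
    l2NormOn A f ^ 2 + l2NormOn Aᶜ f ^ 2 = ‖f‖ ^ 2 := by
  rw [l2NormOn_sq, l2NormOn_sq, L2R_norm_sq, integral_add_compl hA (integrable_norm_sq f)]

lemma exists_add_supportedIn (f : L2R) {A : Set ℝ} (hA : MeasurableSet A) :
    ∃ p q : L2R, f = p + q ∧ SupportedIn p A ∧ SupportedIn q Aᶜ ∧ ‖q‖ = l2NormOn Aᶜ f := by
  have hm : MemLp (Aᶜ.indicator f) 2 (volume : Measure ℝ) := (memLp_L2R f).indicator hA.compl
  refine ⟨f - hm.toLp _, hm.toLp _, (sub_add_cancel _ _).symm, ?_, ?_, ?_⟩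
  · filter_upwards [hm.coeFn_toLp, Lp.coeFn_sub f (hm.toLp _)] with x h1 h2 hx
    rw [h2, Pi.sub_apply, h1, Set.indicator_of_mem hx, sub_self]
  · filter_upwards [hm.coeFn_toLp] with x h1 hx
    rw [h1, Set.indicator_of_notMem hx]
  · rw [Lp.norm_toLp, eLpNorm_indicator_eq_eLpNorm_restrict hA.compl, l2NormOn]

lemma inner_eq_zero_of_supportedIn {p q : L2R} {A : Set ℝ} (hp : SupportedIn p A)
    (hq : SupportedIn q Aᶜ) : (inner ℂ q p : ℂ) = 0 := by
  rw [L2.inner_def]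
  refine integral_eq_zero_of_ae ?_
  filter_upwards [hp, hq] with x h1 h2
  by_cases hx : x ∈ A
  · simp [h2 (not_not.2 hx)]
  · simp [h1 hx]

/-- For the converse, `f` is split into `P` with spectrum in `T` and a remainder `Q` whose norm is
that of `𝓕 f` outside `T`. -/
theorem isStrongAnnihilatingPair_iff {S T : Set ℝ} (hT : MeasurableSet T) :
    IsStrongAnnihilatingPair S T ↔ ∃ D : ℝ, IsStrongAnnihilatingPairWith S T D := by
  constructor
  · rintro ⟨C, hC⟩
    -- The sign of `C` is not prescribed; the maximum makes it invertible.
    have hpos : 0 < max C 1 := lt_max_of_lt_right one_pos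
    refine ⟨(max C 1)⁻¹, inv_pos.2 hpos, fun f hf => ?_⟩
    rw [inv_mul_le_iff₀ hpos]
    refine (hC f).trans ?_
    rw [(l2NormOn_compl_eq_zero_iff hT _).2 hf, add_zero]
    exact mul_le_mul_of_nonneg_right (le_max_left _ _) (l2NormOn_nonneg _ _)
  · rintro ⟨D, hD, h⟩
    -- From `‖f‖ ≤ ‖P‖ + ‖Q‖` and `‖P‖ ≤ D⁻¹ (‖f‖_{L²(Sᶜ)} + ‖Q‖)`.
    refine ⟨D⁻¹ + 1, fun f => ?_⟩
    obtain ⟨p, q, hpq, hp, -, hqn⟩ := exists_add_supportedIn (𝓕 f : L2R) hT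
    set P : L2R := 𝓕⁻ p
    set Q : L2R := 𝓕⁻ q
    have hf : f = P + Q := by
      rw [← fourierInv_fourier_eq (F := L2R) f, hpq]
      exact (Lp.fourierTransformₗᵢ ℝ ℂ).symm.map_add p q
    have hPf : P = f + (-1 : ℂ) • Q := by rw [hf]; simp
    have hQ : ‖Q‖ = l2NormOn Tᶜ (𝓕 f : L2R) := by
      rw [← hqn]
      exact (Lp.fourierTransformₗᵢ ℝ ℂ).symm.norm_map q
    have hP : SpectrumIn P T := by
      rw [SpectrumIn, show (𝓕 P : L2R) = p from fourier_fourierInv_eq p]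
      exact hp
    have h1 : ‖P‖ ≤ D⁻¹ * l2NormOn Sᶜ P := by
      rw [← div_eq_inv_mul, le_div_iff₀ hD, mul_comm]
      exact h P hP
    have h2 : l2NormOn Sᶜ P ≤ l2NormOn Sᶜ f + ‖Q‖ := by
      rw [hPf]
      refine (l2NormOn_add_le _ _ _).trans ?_
      rw [l2NormOn_smul, norm_neg, norm_one, one_mul]
      gcongr
      exact l2NormOn_le_norm _ _
    have h3 : ‖f‖ ≤ ‖P‖ + ‖Q‖ := hf ▸ norm_add_le P Q
    have hDi : 0 < D⁻¹ := inv_pos.2 hD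
    have h4 := mul_le_mul_of_nonneg_left h2 hDi.le
    rw [← hQ]
    nlinarith [l2NormOn_nonneg Sᶜ f]

/-- Bounded sequences in `L²` have weakly convergent subsequences. -/
lemma exists_weak_subseq_tendsto {h : ℕ → L2R} {r : ℝ} (hr : ∀ n, ‖h n‖ ≤ r) :
    ∃ (g : L2R) (σ : ℕ → ℕ), StrictMono σ ∧ ‖g‖ ≤ r ∧ ∀ y : L2R,
      Filter.Tendsto (fun n => (inner ℂ y (h (σ n)) : ℂ)) Filter.atTop (nhds (inner ℂ y g)) := by
  have : Fact ((2 : ENNReal) ≠ ⊤) := ⟨ENNReal.ofNat_ne_top⟩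
  obtain ⟨φ, hφ, σ, hσ, hlim⟩ := WeakDual.isSeqCompact_closedBall ℂ L2R 0 r
    (x := fun n => WeakDual.toStrongDual.symm (InnerProductSpace.toDual ℂ L2R (h n)))
    fun n => by simpa using hr n
  set g := (InnerProductSpace.toDual ℂ L2R).symm (WeakDual.toStrongDual φ)
  refine ⟨g, σ, hσ, by simpa [g] using hφ, fun y => ?_⟩
  have h1 := ((WeakDual.eval_continuous y).tendsto φ).comp hlim
  have h2 : φ y = inner ℂ g y := by
    rw [← InnerProductSpace.toDual_apply_apply]
    simp [g]
  rw [h2] at h1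
  -- The Riesz map puts the limit in the first slot of the inner product; conjugation exchanges the
  -- slots.
  have h3 := (Complex.continuous_conj.tendsto _).comp h1
  simpa [Function.comp_def, inner_conj_symm] using h3

/-- The Amrein–Berthier theorem: sets of finite measure form strong annihilating pairs. -/
theorem exists_isStrongAnnihilatingPairWith {S T : Set ℝ} (hS : MeasurableSet S)
    (hT : MeasurableSet T) (hSfin : volume S < ⊤) (hTfin : volume T < ⊤) :
    ∃ D : ℝ, IsStrongAnnihilatingPairWith S T D := by
  by_contra! hno
  have hex : ∀ n : ℕ, ∃ g : L2R, ‖g‖ = 1 ∧ SpectrumIn g T ∧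
      l2NormOn Sᶜ g ≤ 1 / ((n : ℝ) + 1) := by
    intro n
    have h1 := hno (1 / ((n : ℝ) + 1))
    simp only [IsStrongAnnihilatingPairWith, not_and, not_forall, not_le] at h1
    obtain ⟨f, hfT, hf⟩ := h1 (by positivity)
    have hf0 : 0 < ‖f‖ := by
      refine (norm_nonneg f).lt_of_ne fun h0 => ?_
      rw [← h0, mul_zero] at hf
      exact absurd (l2NormOn_nonneg _ _) hf.not_ge
    have hn : ‖((‖f‖⁻¹ : ℝ) : ℂ)‖ = ‖f‖⁻¹ := by simp
    refine ⟨((‖f‖⁻¹ : ℝ) : ℂ) • f, ?_, ?_, ?_⟩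
    · rw [norm_smul, hn, inv_mul_cancel₀ hf0.ne']
    · have := (supportedSubmodule T).smul_mem ((‖f‖⁻¹ : ℝ) : ℂ) hfT
      rw [SpectrumIn, FourierTransform.fourier_smul]
      exact this
    · rw [l2NormOn_smul, hn, inv_mul_le_iff₀ hf0, mul_comm]
      exact hf.le
  choose g hg1 hgT hgS using hex
  obtain ⟨h, σ, hσ, hh1, hlim⟩ := exists_weak_subseq_tendsto (h := fun n => (𝓕 (g n) : L2R))
    (r := 1) fun n => by rw [Lp.norm_fourier_eq, hg1]
  have hF : (𝓕 (𝓕⁻ h : L2R) : L2R) = h := fourier_fourierInv_eq h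
  set f : L2R := 𝓕⁻ h
  have hfT : SpectrumIn f T := by
    -- The part `q` of `h` outside `T` is orthogonal to every `𝓕 (g n)`, hence to the weak limit
    -- `h`, hence to itself.
    obtain ⟨p, q, hpq, hp, hq, hqn⟩ := exists_add_supportedIn h hT
    have h0 : (inner ℂ q h : ℂ) = 0 := by
      refine tendsto_nhds_unique (hlim q) ?_
      simp only [inner_eq_zero_of_supportedIn (hgT _) hq]
      exact tendsto_const_nhds
    rw [hpq, inner_add_right, inner_eq_zero_of_supportedIn hp hq, zero_add,
      inner_self_eq_zero] at h0
    rw [SpectrumIn, hF, hpq, h0, add_zero]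
    exact hp
  have hfn : ‖f‖ ≤ 1 := by rwa [← Lp.norm_fourier_eq, hF]
  -- The kernel gives `|g(x)|² ≤ |T|`, integrable over `S`, and turns weak convergence of the
  -- transforms into pointwise convergence.
  have hconv : Filter.Tendsto (fun n => ∫ x in S, ‖g (σ n) x‖ ^ 2) Filter.atTop
      (nhds (∫ x in S, ‖f x‖ ^ 2)) := by
    refine tendsto_integral_of_dominated_convergence (fun _ => volume.real T)
      (fun n => (integrable_norm_sq _).integrableOn.aestronglyMeasurable)
      (integrableOn_const hSfin.ne) (fun n => ?_) ?_
    · refine ae_restrict_of_ae ?_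
      filter_upwards [(hgT (σ n)).ae_eq_inner hT hTfin] with x hx
      rw [Real.norm_of_nonneg (by positivity), hx, ← norm_sq_bandKernel hT hTfin x]
      gcongr
      refine (norm_inner_le_norm _ _).trans ?_
      rw [Lp.norm_fourier_eq, hg1, mul_one]
    · refine ae_restrict_of_ae ?_
      filter_upwards [ae_all_iff.2 fun n => (hgT (σ n)).ae_eq_inner hT hTfin,
        hfT.ae_eq_inner hT hTfin] with x h1 h2
      simp only [h1, h2, hF]
      exact (hlim _).norm.pow 2
  have hlow : 1 ≤ ∫ x in S, ‖f x‖ ^ 2 := by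
    have hz : Filter.Tendsto (fun n : ℕ => 1 - (1 / ((n : ℝ) + 1)) ^ 2) Filter.atTop (nhds 1) := by
      simpa using (tendsto_one_div_add_atTop_nhds_zero_nat (𝕜 := ℝ)).pow 2 |>.const_sub 1
    refine le_of_tendsto_of_tendsto' (hz.comp hσ.tendsto_atTop) hconv fun n => ?_
    have h1 := l2NormOn_sq_add_compl hS (g (σ n))
    have h2 : l2NormOn Sᶜ (g (σ n)) ^ 2 ≤ (1 / (((σ n : ℕ) : ℝ) + 1)) ^ 2 :=
      pow_le_pow_left₀ (l2NormOn_nonneg _ _) (hgS _) 2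
    rw [hg1, l2NormOn_sq] at h1
    simp only [Function.comp_apply]
    linarith
  -- Mass at least 1 in `S` and total mass at most 1 leave nothing outside `S`.
  have hfS : SupportedIn f S := by
    rw [← l2NormOn_compl_eq_zero_iff hS]
    have h1 := l2NormOn_sq_add_compl hS f
    rw [l2NormOn_sq] at h1
    have h2 : ‖f‖ ^ 2 ≤ 1 := pow_le_one₀ (norm_nonneg _) hfn
    have h3 : l2NormOn Sᶜ f ^ 2 ≤ 0 := by linarith
    exact pow_eq_zero_iff two_ne_zero |>.1 (h3.antisymm (sq_nonneg _))
  have h0 := isAnnihilatingPair_of_volume_lt_top hS hT hSfin hTfin f hfS hfT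
  have h1 := integral_norm_sq_of_supportedIn hS hfS
  rw [h0] at h1 hlow
  rw [h1, norm_zero] at hlow
  norm_num at hlow

/-! ### Solutions of the free Schrödinger equation -/

/-- Differentiating a Fourier transform twice multiplies the function by `-4π²ξ²`. -/
lemma deriv_deriv_fourier {ψ : ℝ → ℂ} (hψ : Continuous ψ) (hc : HasCompactSupport ψ) :
    deriv (deriv (𝓕 ψ)) = 𝓕 fun ξ : ℝ => -(4 * Real.pi ^ 2 * ξ ^ 2 : ℂ) * ψ ξ := by
  have hint : ∀ p : ℝ → ℂ, Continuous p → Integrable fun ξ => p ξ * ψ ξ := fun p hp =>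
    (hp.mul hψ).integrable_of_hasCompactSupport hc.mul_left
  rw [Real.deriv_fourier (by simpa using hint (fun _ => 1) continuous_const)
    (by simpa using hint (fun ξ => ξ) (by fun_prop))]
  rw [Real.deriv_fourier (by simpa using hint (fun ξ => -2 * Real.pi * Complex.I * ξ) (by fun_prop))
    (by simpa [mul_assoc] using hint (fun ξ => ξ * (-2 * Real.pi * Complex.I * ξ)) (by fun_prop))]
  congr 1
  ext ξ
  simp only [smul_eq_mul]
  linear_combination (4 * Real.pi ^ 2 * ξ ^ 2 * ψ ξ : ℂ) * Complex.I_sq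

/-- The Schrödinger equation on the Fourier side. -/
lemma IsFreeSchrodingerSolution.hasDerivAt_integral_fourier {v₀ : L2R} {v : ℝ → L2R}
    (hv : IsFreeSchrodingerSolution v₀ v) {ψ : ℝ → ℂ} (hψ : ContDiff ℝ (⊤ : ℕ∞) ψ)
    (hc : HasCompactSupport ψ) {t : ℝ} (ht : 0 < t) :
    HasDerivAt (fun s => ∫ ξ, (𝓕 (v s) : L2R) ξ * ψ ξ)
      (-∫ ξ, (𝓕 (v t) : L2R) ξ * (Complex.I * Real.pi * ξ ^ 2 * ψ ξ)) t := by
  set φ : 𝓢(ℝ, ℂ) := hc.toSchwartzMap hψ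
  have hc₂ : HasCompactSupport fun ξ : ℝ => -(4 * Real.pi ^ 2 * ξ ^ 2 : ℂ) * ψ ξ := hc.mul_left
  have hψ₂ : ContDiff ℝ (⊤ : ℕ∞) fun ξ : ℝ => -(4 * Real.pi ^ 2 * ξ ^ 2 : ℂ) * ψ ξ := by
    have : ContDiff ℝ (⊤ : ℕ∞) fun ξ : ℝ => (ξ : ℂ) := Complex.ofRealCLM.contDiff
    fun_prop
  set φ₂ : 𝓢(ℝ, ℂ) := hc₂.toSchwartzMap hψ₂
  obtain ⟨d, hd, hde⟩ := hv.equation (𝓕 φ) t ht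
  simp_rw [← integral_L2_fourier_mul] at hd
  have h2 : deriv (deriv ((𝓕 φ : 𝓢(ℝ, ℂ)) : ℝ → ℂ)) = (𝓕 φ₂ : 𝓢(ℝ, ℂ)) := by
    rw [SchwartzMap.fourier_coe, SchwartzMap.fourier_coe]
    exact deriv_deriv_fourier hψ.continuous hc
  rw [h2, ← integral_L2_fourier_mul] at hde
  -- `-4π²ξ² = 4πi · iπξ²`; the factor `4π` cancels the coefficient of the equation.
  have h3 : ∫ ξ, (𝓕 (v t) : L2R) ξ * φ₂ ξ = (4 * Real.pi * Complex.I) *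
      ∫ ξ, (𝓕 (v t) : L2R) ξ * (Complex.I * Real.pi * ξ ^ 2 * ψ ξ) := by
    rw [← integral_const_mul]
    refine integral_congr_ae (.of_forall fun ξ => ?_)
    have : φ₂ ξ = -(4 * Real.pi ^ 2 * ξ ^ 2 : ℂ) * ψ ξ := rfl
    simp only [this]
    linear_combination (-4 * Real.pi ^ 2 * ξ ^ 2 * ψ ξ * (𝓕 (v t) : L2R) ξ : ℂ) * Complex.I_sq
  have hpi : (Real.pi : ℂ) ≠ 0 := Complex.ofReal_ne_zero.2 Real.pi_ne_zero
  rw [h3] at hde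
  have h4 : d = -∫ ξ, (𝓕 (v t) : L2R) ξ * (Complex.I * Real.pi * ξ ^ 2 * ψ ξ) := by
    apply mul_left_cancel₀ Complex.I_ne_zero
    have h5 : (1 / (4 * (Real.pi : ℂ))) * ((4 * Real.pi * Complex.I) *
        ∫ ξ, (𝓕 (v t) : L2R) ξ * (Complex.I * Real.pi * ξ ^ 2 * ψ ξ)) =
        Complex.I * ∫ ξ, (𝓕 (v t) : L2R) ξ * (Complex.I * Real.pi * ξ ^ 2 * ψ ξ) := by
      field_simp
    rw [h5] at hde
    linear_combination hde
  rw [← h4]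
  exact hd

/-! ### Integrals against the Schrödinger phase -/

lemma integrable_L2_mul (f : L2R) {k : ℝ → ℂ} (hk : MemLp k 2 (volume : Measure ℝ)) :
    Integrable fun x => f x * k x :=
  (memLp_L2R f).integrable_mul hk

/-- The Cauchy–Schwarz inequality against a fixed function. -/
lemma exists_integral_norm_mul_le {k : ℝ → ℂ} (hk : MemLp k 2 (volume : Measure ℝ)) :
    ∃ C : ℝ, 0 ≤ C ∧ ∀ f : L2R, ∫ x, ‖f x * k x‖ ≤ C * ‖f‖ := by
  refine ⟨(∫ x, ‖k x‖ ^ (2 : ℝ)) ^ (1 / 2 : ℝ), by positivity, fun f => ?_⟩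
  have h := integral_mul_norm_le_Lp_mul_Lq (μ := (volume : Measure ℝ)) (p := 2) (q := 2)
    ⟨by norm_num, by norm_num, by norm_num⟩ (f := f) (g := k)
    (by simpa using memLp_L2R f) (by simpa using hk)
  have hf : (∫ x, ‖f x‖ ^ (2 : ℝ)) ^ (1 / 2 : ℝ) = ‖f‖ := by
    simp only [Real.rpow_ofNat]
    rw [← L2R_norm_sq, ← Real.sqrt_eq_rpow, Real.sqrt_sq (norm_nonneg _)]
  rw [hf] at h
  simp only [norm_mul]
  linarith

/-- The symbol `e^{iπsξ²}` of the backward Schrödinger propagator. -/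
noncomputable def schrodingerPhase (s ξ : ℝ) : ℂ :=
  Complex.exp (Complex.I * (Real.pi * s * ξ ^ 2 : ℝ))

lemma norm_schrodingerPhase (s ξ : ℝ) : ‖schrodingerPhase s ξ‖ = 1 := by
  rw [schrodingerPhase, mul_comm, Complex.norm_exp_ofReal_mul_I]

lemma contDiff_schrodingerPhase (s : ℝ) : ContDiff ℝ (⊤ : ℕ∞) (schrodingerPhase s) := by
  have : ContDiff ℝ (⊤ : ℕ∞) fun ξ : ℝ => ((Real.pi * s * ξ ^ 2 : ℝ) : ℂ) :=
    Complex.ofRealCLM.contDiff.comp (contDiff_const.mul (contDiff_id.pow 2))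
  unfold schrodingerPhase
  fun_prop

lemma hasDerivAt_schrodingerPhase (s ξ : ℝ) :
    HasDerivAt (fun s => schrodingerPhase s ξ)
      (Complex.I * Real.pi * ξ ^ 2 * schrodingerPhase s ξ) s := by
  have h : HasDerivAt (fun s : ℝ => Complex.I * ((Real.pi * s * ξ ^ 2 : ℝ) : ℂ))
      (Complex.I * ((Real.pi * 1 * ξ ^ 2 : ℝ) : ℂ)) s :=
    (HasDerivAt.ofReal_comp (((hasDerivAt_id s).const_mul _).mul_const _)).const_mul _
  convert! h.cexp using 1
  simp only [schrodingerPhase]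
  push_cast
  ring

lemma norm_schrodingerPhase_sub_le (s t ξ : ℝ) :
    ‖schrodingerPhase s ξ - schrodingerPhase t ξ‖ ≤ |s - t| * (Real.pi * ξ ^ 2) := by
  have h : schrodingerPhase s ξ - schrodingerPhase t ξ = schrodingerPhase t ξ *
      (Complex.exp (Complex.I * (Real.pi * (s - t) * ξ ^ 2 : ℝ)) - 1) := by
    rw [mul_sub, mul_one, schrodingerPhase, schrodingerPhase, ← Complex.exp_add]
    congr 2
    push_cast
    ring
  rw [h, norm_mul, norm_schrodingerPhase, one_mul]
  refine (Real.norm_exp_I_mul_ofReal_sub_one_le).trans (le_of_eq ?_)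
  rw [Real.norm_eq_abs, abs_mul, abs_mul, abs_of_pos Real.pi_pos, abs_of_nonneg (sq_nonneg ξ)]
  ring

section Conservation

variable {u : ℝ → L2R} {ψ : ℝ → ℂ}

lemma memLp_schrodingerPhase_mul (hψ : Continuous ψ) (hc : HasCompactSupport ψ) (s : ℝ) :
    MemLp (fun ξ => schrodingerPhase s ξ * ψ ξ) 2 (volume : Measure ℝ) :=
  ((contDiff_schrodingerPhase s).continuous.mul hψ).memLp_of_hasCompactSupport hc.mul_left

lemma memLp_quadratic_mul (hψ : Continuous ψ) (hc : HasCompactSupport ψ) :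
    MemLp (fun ξ : ℝ => (Real.pi * ξ ^ 2 : ℂ) * ψ ξ) 2 (volume : Measure ℝ) :=
  Continuous.memLp_of_hasCompactSupport (by fun_prop) hc.mul_left

lemma norm_phase_sub_mul_le (ψ : ℝ → ℂ) (s t ξ : ℝ) :
    ‖schrodingerPhase s ξ * ψ ξ - schrodingerPhase t ξ * ψ ξ‖ ≤
      |s - t| * ‖(Real.pi * ξ ^ 2 : ℂ) * ψ ξ‖ := by
  rw [← sub_mul, norm_mul, norm_mul, ← mul_assoc]
  gcongr
  refine (norm_schrodingerPhase_sub_le s t ξ).trans (le_of_eq ?_)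
  congr 1
  rw [← Complex.ofReal_pow, ← Complex.ofReal_mul, Complex.norm_real,
    Real.norm_of_nonneg (by positivity)]

/-- Compact support of `ψ` absorbs the growth `ξ²` of the time derivative of the phase, so `C` is
uniform in `f`, `s` and `t`. -/
lemma exists_norm_integral_phase_sub_le (hψ : Continuous ψ) (hc : HasCompactSupport ψ) :
    ∃ C : ℝ, 0 ≤ C ∧ ∀ (f : L2R) (s t : ℝ),
      ‖∫ ξ, f ξ * (schrodingerPhase s ξ * ψ ξ - schrodingerPhase t ξ * ψ ξ)‖ ≤
        C * ‖f‖ * |s - t| := by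
  obtain ⟨C, hC0, hC⟩ := exists_integral_norm_mul_le (memLp_quadratic_mul hψ hc)
  refine ⟨C, hC0, fun f s t => ?_⟩
  have hi := (integrable_L2_mul f (memLp_quadratic_mul hψ hc)).norm
  calc ‖∫ ξ, f ξ * (schrodingerPhase s ξ * ψ ξ - schrodingerPhase t ξ * ψ ξ)‖
      ≤ ∫ ξ, |s - t| * ‖f ξ * ((Real.pi * ξ ^ 2 : ℂ) * ψ ξ)‖ := by
        refine norm_integral_le_of_norm_le (hi.const_mul _) (.of_forall fun ξ => ?_)
        rw [norm_mul, norm_mul (f ξ), mul_left_comm]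
        gcongr
        exact norm_phase_sub_mul_le ψ s t ξ
    _ ≤ C * ‖f‖ * |s - t| := by
        rw [integral_const_mul, mul_comm]
        gcongr
        exact hC f

lemma continuousOn_integral_phase (hu : ContinuousOn u (Set.Ici 0)) (hψ : Continuous ψ)
    (hc : HasCompactSupport ψ) :
    ContinuousOn (fun s => ∫ ξ, u s ξ * (schrodingerPhase s ξ * ψ ξ)) (Set.Ici 0) := by
  intro t ht
  obtain ⟨C, hC0, hC⟩ := exists_norm_integral_phase_sub_le hψ hc
  obtain ⟨C', hC'0, hC'⟩ := exists_integral_norm_mul_le (memLp_schrodingerPhase_mul hψ hc t)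
  have hb : ∀ s, ‖(∫ ξ, u s ξ * (schrodingerPhase s ξ * ψ ξ)) -
      ∫ ξ, u t ξ * (schrodingerPhase t ξ * ψ ξ)‖ ≤
      C * ‖u s‖ * |s - t| + C' * ‖u s - u t‖ := by
    intro s
    have hi := fun f r => integrable_L2_mul f (memLp_schrodingerPhase_mul hψ hc r)
    have e : (∫ ξ, u s ξ * (schrodingerPhase s ξ * ψ ξ)) -
        ∫ ξ, u t ξ * (schrodingerPhase t ξ * ψ ξ) =
        (∫ ξ, u s ξ * (schrodingerPhase s ξ * ψ ξ - schrodingerPhase t ξ * ψ ξ)) +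
          ∫ ξ, (u s - u t : L2R) ξ * (schrodingerPhase t ξ * ψ ξ) := by
      have e1 : ∫ ξ, (u s - u t : L2R) ξ * (schrodingerPhase t ξ * ψ ξ) =
          (∫ ξ, u s ξ * (schrodingerPhase t ξ * ψ ξ)) -
            ∫ ξ, u t ξ * (schrodingerPhase t ξ * ψ ξ) := by
        rw [← integral_sub (hi _ _) (hi _ _)]
        refine integral_congr_ae ?_
        filter_upwards [Lp.coeFn_sub (u s) (u t)] with ξ h
        rw [h, Pi.sub_apply, sub_mul]
      simp only [mul_sub]
      rw [integral_sub (hi _ _) (hi _ _), e1]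
      ring
    rw [e]
    exact (norm_add_le _ _).trans (add_le_add (hC _ _ _)
      ((norm_integral_le_integral_norm _).trans (hC' _)))
  have hut : Filter.Tendsto u (nhdsWithin t (Set.Ici 0)) (nhds (u t)) := hu t ht
  have hid : Filter.Tendsto (fun s : ℝ => s) (nhdsWithin t (Set.Ici 0)) (nhds t) :=
    tendsto_nhdsWithin_of_tendsto_nhds Filter.tendsto_id
  refine tendsto_iff_norm_sub_tendsto_zero.2 (squeeze_zero (fun _ => norm_nonneg _) hb ?_)
  have h1 := ((hut.norm.const_mul C).mul (hid.sub_const t).abs).add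
    ((hut.sub_const (u t)).norm.const_mul C')
  simpa using h1

lemma hasDerivAt_integral_const_phase (f : L2R) (hψ : Continuous ψ) (hc : HasCompactSupport ψ)
    (t : ℝ) :
    HasDerivAt (fun s => ∫ ξ, f ξ * (schrodingerPhase s ξ * ψ ξ))
      (∫ ξ, f ξ * (Complex.I * Real.pi * ξ ^ 2 * (schrodingerPhase t ξ * ψ ξ))) t := by
  have hm : MemLp (fun ξ : ℝ => Complex.I * Real.pi * ξ ^ 2 * (schrodingerPhase t ξ * ψ ξ)) 2
      (volume : Measure ℝ) :=
    Continuous.memLp_of_hasCompactSupport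
      (by have := (contDiff_schrodingerPhase t).continuous; fun_prop) hc.mul_left.mul_left
  refine (hasDerivAt_integral_of_dominated_loc_of_deriv_le (s := Set.univ)
    (bound := fun ξ => ‖f ξ * ((Real.pi * ξ ^ 2 : ℂ) * ψ ξ)‖)
    (F' := fun s ξ => f ξ * (Complex.I * Real.pi * ξ ^ 2 * (schrodingerPhase s ξ * ψ ξ)))
    Filter.univ_mem (.of_forall fun s =>
      (integrable_L2_mul f (memLp_schrodingerPhase_mul hψ hc s)).aestronglyMeasurable)
    (integrable_L2_mul f (memLp_schrodingerPhase_mul hψ hc t))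
    (integrable_L2_mul f hm).aestronglyMeasurable
    (.of_forall fun ξ s _ => le_of_eq ?_)
    (integrable_L2_mul f (memLp_quadratic_mul hψ hc)).norm
    (.of_forall fun ξ s _ => ?_)).2
  · simp [norm_schrodingerPhase]
  · rw [← mul_assoc (_ * _ * _)]
    exact ((hasDerivAt_schrodingerPhase s ξ).mul_const _).const_mul _

end Conservation

lemma L2R_continuous_fourier : Continuous fun f : L2R => (𝓕 f : L2R) :=
  (Lp.fourierTransformₗᵢ ℝ ℂ).continuous

lemma IsFreeSchrodingerSolution.continuousOn_fourier {v₀ : L2R} {v : ℝ → L2R}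
    (hv : IsFreeSchrodingerSolution v₀ v) :
    ContinuousOn (fun s => (𝓕 (v s) : L2R)) (Set.Ici 0) :=
  L2R_continuous_fourier.comp_continuousOn hv.continuousOn

/-- Along a solution, `∫ v̂(ξ, s) e^{iπsξ²} ψ(ξ) dξ` has derivative zero. -/
lemma IsFreeSchrodingerSolution.hasDerivAt_integral_phase {v₀ : L2R} {v : ℝ → L2R}
    (hv : IsFreeSchrodingerSolution v₀ v) {ψ : ℝ → ℂ} (hψ : ContDiff ℝ (⊤ : ℕ∞) ψ)
    (hc : HasCompactSupport ψ) {t : ℝ} (ht : 0 < t) :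
    HasDerivAt (fun s => ∫ ξ, (𝓕 (v s) : L2R) ξ * (schrodingerPhase s ξ * ψ ξ)) 0 t := by
  set u : ℝ → L2R := fun s => 𝓕 (v s)
  have hut : ContinuousAt u t := hv.continuousOn_fourier.continuousAt (Ici_mem_nhds ht)
  obtain ⟨C, hC0, hC⟩ := exists_norm_integral_phase_sub_le hψ.continuous hc
  -- With `θ_s = schrodingerPhase s`, the splitting `u_s θ_s = (u_s - u_t)(θ_s - θ_t) + u_t θ_s +
  -- u_s θ_t - u_t θ_t` replaces the product rule, as `u` is only weakly differentiable. The first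
  -- term is `o(s - t)` by norm continuity of `u`; the derivatives of the next two cancel.
  have h1 : HasDerivAt (fun s => ∫ ξ, (u s - u t : L2R) ξ *
      (schrodingerPhase s ξ * ψ ξ - schrodingerPhase t ξ * ψ ξ)) 0 t := by
    rw [hasDerivAt_iff_isLittleO, Asymptotics.isLittleO_iff]
    intro ε hε
    have hlim : Filter.Tendsto (fun s => C * ‖u s - u t‖) (nhds t) (nhds 0) := by
      simpa using (Filter.Tendsto.norm (hut.tendsto.sub_const (u t))).const_mul C
    filter_upwards [hlim.eventually (ge_mem_nhds hε)] with s hs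
    simp only [sub_self, mul_zero, integral_zero, sub_zero, smul_zero]
    refine (hC _ _ _).trans ?_
    rw [Real.norm_eq_abs]
    gcongr
  have h2 := hasDerivAt_integral_const_phase (u t) hψ.continuous hc t
  have h3 := hv.hasDerivAt_integral_fourier ((contDiff_schrodingerPhase t).mul hψ)
    hc.mul_left ht
  have h4 := ((h1.add h2).add h3).sub_const (∫ ξ, u t ξ * (schrodingerPhase t ξ * ψ ξ))
  have hi := fun f r => integrable_L2_mul f (memLp_schrodingerPhase_mul hψ.continuous hc r)
  refine (h4.congr_deriv (by simp [u])).congr_of_eventuallyEq (.of_forall fun s => ?_)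
  have e : ∫ ξ, (u s - u t : L2R) ξ *
      (schrodingerPhase s ξ * ψ ξ - schrodingerPhase t ξ * ψ ξ) =
      ((∫ ξ, u s ξ * (schrodingerPhase s ξ * ψ ξ)) -
        ∫ ξ, u t ξ * (schrodingerPhase s ξ * ψ ξ)) -
      ((∫ ξ, u s ξ * (schrodingerPhase t ξ * ψ ξ)) -
        ∫ ξ, u t ξ * (schrodingerPhase t ξ * ψ ξ)) := by
    rw [← integral_sub (hi _ _) (hi _ _), ← integral_sub (hi _ _) (hi _ _),
      ← integral_sub (by exact (hi _ _).sub (hi _ _)) (by exact (hi _ _).sub (hi _ _))]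
    refine integral_congr_ae ?_
    filter_upwards [Lp.coeFn_sub (u s) (u t)] with ξ h
    rw [h, Pi.sub_apply]
    ring
  simp only [Pi.add_apply, e]
  ring

/-- Solutions are given by `v̂(ξ, t) = e^{-iπtξ²} v̂₀(ξ)`. -/
theorem IsFreeSchrodingerSolution.fourier_eq {v₀ : L2R} {v : ℝ → L2R}
    (hv : IsFreeSchrodingerSolution v₀ v) {t : ℝ} (ht : 0 ≤ t) :
    ∀ᵐ ξ : ℝ, schrodingerPhase t ξ * (𝓕 (v t) : L2R) ξ = (𝓕 v₀ : L2R) ξ := by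
  have key : ∀ ψ : ℝ → ℂ, ContDiff ℝ (⊤ : ℕ∞) ψ → HasCompactSupport ψ →
      ∫ ξ, (𝓕 (v t) : L2R) ξ * (schrodingerPhase t ξ * ψ ξ) = ∫ ξ, (𝓕 v₀ : L2R) ξ * ψ ξ := by
    intro ψ hψ hc
    set H : ℝ → ℂ := fun s => ∫ ξ, (𝓕 (v s) : L2R) ξ * (schrodingerPhase s ξ * ψ ξ)
    have hH0 : H 0 = ∫ ξ, (𝓕 v₀ : L2R) ξ * ψ ξ := by
      simp [H, schrodingerPhase, hv.initial]
    have hd : ∀ s ∈ Set.Ioi (0 : ℝ), HasDerivAt H 0 s := fun s hs =>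
      hv.hasDerivAt_integral_phase hψ hc hs
    have hcont : ContinuousOn H (Set.Ici 0) :=
      continuousOn_integral_phase hv.continuousOn_fourier hψ.continuous hc
    rw [← hH0]
    rcases ht.eq_or_lt with rfl | ht
    · rfl
    have hconst : ∀ s ∈ Set.Ioi (0 : ℝ), H s = H t := fun s hs =>
      isOpen_Ioi.is_const_of_deriv_eq_zero isPreconnected_Ioi
        (fun r hr => (hd r hr).differentiableAt.differentiableWithinAt)
        (fun r hr => (hd r hr).deriv) hs ht
    -- The equation holds only for positive times; continuity at 0 brings in the initial data.
    have hlim : Filter.Tendsto H (nhdsWithin 0 (Set.Ioi 0)) (nhds (H 0)) :=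
      (hcont 0 Set.self_mem_Ici).mono_left (nhdsWithin_mono _ Set.Ioi_subset_Ici_self)
    refine tendsto_nhds_unique (tendsto_const_nhds.congr' ?_) hlim
    filter_upwards [self_mem_nhdsWithin] with s hs using (hconst s hs).symm
  have hL2 : MemLp (fun ξ => schrodingerPhase t ξ * (𝓕 (v t) : L2R) ξ) 2
      (volume : Measure ℝ) := by
    refine (memLp_L2R (𝓕 (v t) : L2R)).mono
      ((contDiff_schrodingerPhase t).continuous.aestronglyMeasurable.mul (memLp_L2R _).1)
      (.of_forall fun ξ => ?_)
    simp [norm_schrodingerPhase]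
  refine ae_eq_of_integral_contDiff_smul_eq (hL2.locallyIntegrable (by norm_num))
    ((memLp_L2R _).locallyIntegrable (by norm_num)) fun g hg hgc => ?_
  have h := key (Complex.ofRealCLM ∘ g) (by fun_prop) (hgc.comp_left rfl)
  simp only [Complex.real_smul, Function.comp_apply, Complex.ofRealCLM_apply] at h ⊢
  simpa only [mul_comm, mul_left_comm, mul_assoc] using h

/-! ### Conservation of norm and spectrum, and the theorem -/

lemma IsFreeSchrodingerSolution.norm_fourier_apply {v₀ : L2R} {v : ℝ → L2R}
    (hv : IsFreeSchrodingerSolution v₀ v) {t : ℝ} (ht : 0 ≤ t) :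
    ∀ᵐ ξ : ℝ, ‖(𝓕 (v t) : L2R) ξ‖ = ‖(𝓕 v₀ : L2R) ξ‖ := by
  filter_upwards [hv.fourier_eq ht] with ξ h
  rw [← h, norm_mul, norm_schrodingerPhase, one_mul]

theorem IsFreeSchrodingerSolution.norm_eq {v₀ : L2R} {v : ℝ → L2R}
    (hv : IsFreeSchrodingerSolution v₀ v) {t : ℝ} (ht : 0 ≤ t) : ‖v t‖ = ‖v₀‖ := by
  rw [← Lp.norm_fourier_eq (v t), ← Lp.norm_fourier_eq v₀, Lp.norm_def, Lp.norm_def,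
    eLpNorm_congr_norm_ae (hv.norm_fourier_apply ht)]

theorem IsFreeSchrodingerSolution.spectrumIn {v₀ : L2R} {v : ℝ → L2R}
    (hv : IsFreeSchrodingerSolution v₀ v) {T : Set ℝ} (h0 : SpectrumIn v₀ T) {t : ℝ}
    (ht : 0 ≤ t) : SpectrumIn (v t) T := by
  filter_upwards [hv.norm_fourier_apply ht, h0] with ξ h1 h2 hξ
  rw [← norm_eq_zero, h1, h2 hξ, norm_zero]

theorem IsStrongAnnihilatingPairWith.le_l2NormOn_solution {S T : Set ℝ} {D : ℝ}
    (h : IsStrongAnnihilatingPairWith S T D) {v₀ : L2R} {v : ℝ → L2R}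
    (hv : IsFreeSchrodingerSolution v₀ v) (h0 : SpectrumIn v₀ T) {t : ℝ} (ht : 0 ≤ t) :
    D * ‖v₀‖ ≤ l2NormOn Sᶜ (v t) := by
  rw [← hv.norm_eq ht]
  exact h.2 _ (hv.spectrumIn h0 ht)

theorem mainTheorem4 :
    -- weak annihilating pairs
    (∀ S T : Set ℝ, MeasurableSet S → MeasurableSet T → IsAnnihilatingPair S T →
      ∀ (v₀ : L2R) (v : ℝ → L2R), IsFreeSchrodingerSolution v₀ v → SpectrumIn v₀ T →
        (∃ t : ℝ, 0 < t ∧ SupportedIn (v t) S) → v₀ = 0) ∧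
    -- strong annihilating pairs with constant `D`
    (∀ S T : Set ℝ, MeasurableSet S → MeasurableSet T →
      (IsStrongAnnihilatingPair S T ↔ ∃ D : ℝ, IsStrongAnnihilatingPairWith S T D) ∧
      ∀ D : ℝ, IsStrongAnnihilatingPairWith S T D →
        ∀ (v₀ : L2R) (v : ℝ → L2R), IsFreeSchrodingerSolution v₀ v → SpectrumIn v₀ T →
          ∀ t : ℝ, 0 ≤ t →
            D * ‖v t‖ ≤ l2NormOn Sᶜ (v t) ∧ ‖v t‖ = ‖v₀‖ ∧ D * ‖v₀‖ ≤ l2NormOn Sᶜ (v t)) ∧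
    -- sets of finite measure
    (∀ S T : Set ℝ, MeasurableSet S → MeasurableSet T → volume S < ⊤ → volume T < ⊤ →
      IsAnnihilatingPair S T ∧ IsStrongAnnihilatingPair S T ∧
      ∃ D : ℝ, IsStrongAnnihilatingPairWith S T D ∧
        ∀ (v₀ : L2R) (v : ℝ → L2R), IsFreeSchrodingerSolution v₀ v → SpectrumIn v₀ T →
          ∀ t : ℝ, 0 ≤ t → D ^ 2 * ‖v₀‖ ^ 2 ≤ ∫ x in Sᶜ, ‖v t x‖ ^ 2) := by
  refine ⟨fun S T _ _ hann v₀ v hv h0 ⟨t, ht, hsupp⟩ => ?_, fun S T _ hT =>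
    ⟨isStrongAnnihilatingPair_iff hT, fun D hD v₀ v hv h0 t ht =>
      ⟨hD.2 _ (hv.spectrumIn h0 ht), hv.norm_eq ht, hD.le_l2NormOn_solution hv h0 ht⟩⟩,
    fun S T hS hT hSfin hTfin => ?_⟩
  · rw [← norm_eq_zero, ← hv.norm_eq ht.le, hann _ hsupp (hv.spectrumIn h0 ht.le), norm_zero]
  · obtain ⟨D, hD⟩ := exists_isStrongAnnihilatingPairWith hS hT hSfin hTfin
    refine ⟨isAnnihilatingPair_of_volume_lt_top hS hT hSfin hTfin,
      (isStrongAnnihilatingPair_iff hT).2 ⟨D, hD⟩, D, hD, fun v₀ v hv h0 t ht => ?_⟩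
    rw [← l2NormOn_sq, ← mul_pow]
    exact pow_le_pow_left₀ (mul_nonneg hD.1.le (norm_nonneg _))
      (hD.le_l2NormOn_solution hv h0 ht) 2
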